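/- For every odd prime $p$, $$\sum_{k=0}^{(p-1)/2}\frac{(-1)^k(172k^2+75k+9)}{2^{12k}}\binom{2k}{k}^3\binom{3k}{k}\binom{4k}{2k}\equiv 9p^2+6p^3q_p(2)-9p^4q_p(2)^2 \pmod{p^5},$$ where $q_p(2)=(2^{p-1}-1)/p$ is the Fermat quotient. Here a congruence $x\equiv y\pmod{p^5}$ between rational numbers means that $x-y=p^5\,a/b$ for some integers $a,b$ with $p\nmid b$. -/

import Mathlib

/-- Congruence of rational numbers modulo a positive integer `m`: `x ≡ y (mod m)` means that
`x - y` is `m` times a fraction whose denominator is coprime to `m`. For `m = p ^ n` with `n ≥ 1`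
this says `x - y ∈ p ^ n ℤ_(p)`, where `ℤ_(p)` is the ring of `p`-integral rationals. -/
def RatModEq (m : ℕ) (x y : ℚ) : Prop :=
  ∃ a b : ℤ, b ≠ 0 ∧ IsCoprime b (m : ℤ) ∧ x - y = (m : ℚ) * ((a : ℚ) / (b : ℚ))

/-- The Fermat quotient `q_p(a) = (a ^ (p - 1) - 1) / p`, used for a prime `p`. -/
def fermatQuotient (p : ℕ) (a : ℤ) : ℚ :=
  ((a : ℚ) ^ (p - 1) - 1) / (p : ℚ)

/-! The summand is the value at `s = -1/2` of a family `shiftedTerm β s n`, polynomial in `s`, which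
has a Wilf–Zeilberger companion: the truncated sums at `s + 1` and at `s` differ by `companionTerm β
s m`. The companion is odd under `s ↦ m - 1 - s`, so the corrections at `-1/2, 1/2, ..., m - 1/2`
cancel in pairs. With `M = (p - 1)/2` the sum at `-1/2` therefore equals the sum at `M + 1/2 = p/2`,
which is small `p`-adically.

At `s = p/2` there are three contributions modulo `p^5`. The term `n = 0` is `48 s^2 - 48 s^4`. The
terms `0 < n < M` are `s^4` times a sum needed only modulo `p`; it is `48` (`sum_reducedTerm_zmod`),
because over `ZMod p` the truncated sum is the polynomial `48 (X^p - X)^2`. The top term `n = M`,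
times `16^M`, is `-3 p^2` (`pIntegers.exists_top_shiftedTerm`), since its factorials reduce to
products `∏ (1 + c/i)` that behave like exponentials modulo `p^3`.

The total is `12 p^2 - 3 p^2 / y^2` with `y = 4^M = 2^(p-1) = 1 + p q_p(2)`; expanding `y^(-2)`
gives the claim. The prime `3` is checked directly. -/

/-! ### Falling factorials and the Wilf–Zeilberger pair -/

/-- The falling factorial `s (s - 1) ⋯ (s - n + 1)`. -/
def fallingFactorial {R : Type*} [CommRing R] (s : R) (n : ℕ) : R :=
  ∏ j ∈ Finset.range n, (s - j)

section FallingFactorial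

variable {R : Type*} [CommRing R]

@[simp] theorem fallingFactorial_zero (s : R) : fallingFactorial s 0 = 1 := by
  simp [fallingFactorial]

theorem fallingFactorial_succ (s : R) (n : ℕ) :
    fallingFactorial s (n + 1) = fallingFactorial s n * (s - n) := by
  simp [fallingFactorial, Finset.prod_range_succ]

theorem fallingFactorial_succ' (s : R) (n : ℕ) :
    fallingFactorial s (n + 1) = s * fallingFactorial (s - 1) n := by
  simp only [fallingFactorial, Finset.prod_range_succ']
  rw [mul_comm]
  congr 1
  · simp
  · exact Finset.prod_congr rfl fun j _ => by push_cast; ring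

theorem fallingFactorial_add (s : R) (m n : ℕ) :
    fallingFactorial s (m + n) = fallingFactorial s m * fallingFactorial (s - m) n := by
  simp only [fallingFactorial, Finset.prod_range_add]
  congr 1
  exact Finset.prod_congr rfl fun j _ => by push_cast; ring

theorem fallingFactorial_reflect (s : R) (n : ℕ) :
    fallingFactorial ((n : R) - 1 - s) n = (-1) ^ n * fallingFactorial s n := by
  induction n with
  | zero => simp
  | succ n ih =>
    rw [fallingFactorial_succ', fallingFactorial_succ]
    have : ((n + 1 : ℕ) : R) - 1 - s - 1 = (n : R) - 1 - s := by push_cast; ring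
    rw [this, ih]
    push_cast
    ring

theorem map_fallingFactorial {S : Type*} [CommRing S] (f : R →+* S) (s : R) (n : ℕ) :
    f (fallingFactorial s n) = fallingFactorial (f s) n := by
  simp [fallingFactorial, map_prod]

/-- The quartic polynomial factor of the summand. -/
def quarticFactor (n s : R) : R :=
  (2 * n + 1) ^ 3 * (172 * n ^ 2 + 75 * n + 9)
    - 6 * (2 + 11 * n + 11 * n ^ 2) * (2 * s + 1) * (2 * n + 1) ^ 2
    - 6 * (1 + 10 * n + 19 * n ^ 2) * (2 * s + 1) ^ 2 * (2 * n + 1)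
    + 6 * (3 * n + 1) * (5 * n + 2) * (2 * s + 1) ^ 3
    - 3 * (3 * n + 1) * (2 * s + 1) ^ 4

theorem map_quarticFactor {S : Type*} [CommRing S] (f : R →+* S) (n s : R) :
    f (quarticFactor n s) = quarticFactor (f n) (f s) := by
  simp [quarticFactor, map_ofNat]

/-- The summand with a shift parameter `s`, for a coefficient sequence `β`. -/
def shiftedTerm (β : ℕ → R) (s : R) (n : ℕ) : R :=
  β n * quarticFactor (n : R) s * (fallingFactorial s n ^ 3 * fallingFactorial (s + n) (3 * n))

/-- The companion of `shiftedTerm` under the Wilf–Zeilberger method. -/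
def companionTerm (β : ℕ → R) (s : R) (m : ℕ) : R :=
  -48 * (3 * m + 1) * (3 * m + 2) * β m * (2 * s + 1 - m) *
    (fallingFactorial s m ^ 3 * fallingFactorial (s + m + 1) (3 * m + 2))

/-- Each induction step is one polynomial identity plus one use of the recurrence. Only `i < m` is
required and `β (m + 1)` never occurs, so this also applies over `ZMod p` just before a denominator
vanishes. -/
theorem sum_shiftedTerm_add_one_sub (β : ℕ → R) (s : R) (m : ℕ)
    (hβ : ∀ i < m, 8 * ((i : R) + 1) ^ 5 * (2 * i + 3) ^ 3 * β (i + 1)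
      = 3 * (3 * i + 1) * (3 * i + 2) * β i) :
    ∑ n ∈ Finset.range (m + 1), shiftedTerm β (s + 1) n
      - ∑ n ∈ Finset.range (m + 1), shiftedTerm β s n = companionTerm β s m := by
  induction m with
  | zero =>
    simp [shiftedTerm, companionTerm, quarticFactor, fallingFactorial_succ]
    ring
  | succ m ih =>
    have h := ih fun i hi => hβ i (by omega)
    have hb := hβ m (by omega)
    rw [Finset.sum_range_succ, Finset.sum_range_succ (shiftedTerm β s), add_sub_add_comm, h]
    set P := fallingFactorial s m with hP
    set Q := fallingFactorial (s + m + 1) (3 * m + 2) with hQ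
    have e1 : fallingFactorial s (m + 1) = P * (s - m) := fallingFactorial_succ _ _
    have e2 : fallingFactorial (s + 1) (m + 1) = (s + 1) * P := by
      rw [fallingFactorial_succ', add_sub_cancel_right]
    have e3 : fallingFactorial (s + ((m + 1 : ℕ) : R)) (3 * (m + 1))
        = Q * (s - 2 * m - 1) := by
      rw [show 3 * (m + 1) = (3 * m + 2) + 1 by ring, fallingFactorial_succ, hQ]
      push_cast
      rw [← add_assoc]
      ring
    have e4 : fallingFactorial (s + 1 + ((m + 1 : ℕ) : R)) (3 * (m + 1))
        = (s + m + 2) * Q := by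
      rw [show 3 * (m + 1) = (3 * m + 2) + 1 by ring, fallingFactorial_succ', hQ]
      push_cast
      rw [show s + 1 + ((m : R) + 1) - 1 = s + m + 1 by ring]
      ring
    have e5 : fallingFactorial (s + ((m + 1 : ℕ) : R) + 1) (3 * (m + 1) + 2)
        = (s + m + 2) * Q * (s - 2 * m - 1) * (s - 2 * m - 2) := by
      rw [show 3 * (m + 1) + 2 = ((3 * m + 2) + 1) + 1 + 1 by ring, fallingFactorial_succ,
        fallingFactorial_succ, fallingFactorial_succ', hQ]
      push_cast
      rw [show s + ((m : R) + 1) + 1 - 1 = s + m + 1 by ring]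
      ring
    simp only [shiftedTerm, companionTerm, quarticFactor, e1, e2, e3, e4, e5, ← hP, ← hQ]
    push_cast
    linear_combination (16 * (2 * s + 1 - m) * P ^ 3 * Q) * hb

/-- The signs of the falling factorials multiply to `(-1)^(6m+2) = 1`, so the oddness comes from the
factor `2s + 1 - m` alone. -/
theorem companionTerm_reflect (β : ℕ → R) (s : R) (m : ℕ) :
    companionTerm β ((m : R) - 1 - s) m = -companionTerm β s m := by
  have h1 := fallingFactorial_reflect s m
  have h2 := fallingFactorial_reflect (s + m + 1) (3 * m + 2)
  rw [show ((3 * m + 2 : ℕ) : R) - 1 - (s + m + 1) = (m : R) - 1 - s + m + 1 by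
    push_cast; ring] at h2
  rw [companionTerm, companionTerm, h1, h2]
  have h3 : ((-1 : R) ^ m) ^ 3 * (-1) ^ (3 * m + 2) = 1 := by
    rw [← pow_mul, ← pow_add]
    exact Even.neg_one_pow ⟨3 * m + 1, by ring⟩
  linear_combination (-48 * (3 * m + 1) * (3 * m + 2) * β m * (-(2 * s + 1 - m)) *
    (fallingFactorial s m ^ 3 * fallingFactorial (s + m + 1) (3 * m + 2))) * h3

theorem sum_shiftedTerm_add_natCast (β : ℕ → R) (s : R) (m k : ℕ)
    (hβ : ∀ i < m, 8 * ((i : R) + 1) ^ 5 * (2 * i + 3) ^ 3 * β (i + 1)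
      = 3 * (3 * i + 1) * (3 * i + 2) * β i) :
    ∑ n ∈ Finset.range (m + 1), shiftedTerm β (s + k) n
      = ∑ n ∈ Finset.range (m + 1), shiftedTerm β s n
        + ∑ j ∈ Finset.range k, companionTerm β (s + j) m := by
  induction k with
  | zero => simp
  | succ k ih =>
    rw [Finset.sum_range_succ (fun j : ℕ => companionTerm β (s + j) m), ← add_assoc, ← ih,
      ← sum_shiftedTerm_add_one_sub β (s + k) m hβ, add_sub_cancel, Nat.cast_add, Nat.cast_one,
      add_assoc]

end FallingFactorial

theorem sum_companionTerm_neg_half (β : ℕ → ℚ) (m : ℕ) :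
    ∑ j ∈ Finset.range (m + 1), companionTerm β (-1 / 2 + (j : ℚ)) m = 0 := by
  have h := Finset.sum_range_reflect (fun j : ℕ => companionTerm β (-1 / 2 + (j : ℚ)) m) (m + 1)
  have h2 : ∑ j ∈ Finset.range (m + 1), companionTerm β (-1 / 2 + ((m + 1 - 1 - j : ℕ) : ℚ)) m
      = ∑ j ∈ Finset.range (m + 1), -companionTerm β (-1 / 2 + (j : ℚ)) m := by
    refine Finset.sum_congr rfl fun j hj => ?_
    rw [← companionTerm_reflect]
    have : j ≤ m := by simpa [Nat.lt_succ_iff] using hj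
    congr 1
    rw [Nat.add_sub_cancel]
    push_cast [Nat.cast_sub this]
    ring
  rw [h2, Finset.sum_neg_distrib] at h
  linarith

/-! ### The ring of `p`-integral rationals -/

/-- The subring of `ℚ` of numbers whose denominator is prime to `p`. -/
def pIntegers (p : ℕ) [Fact p.Prime] : Subring ℚ where
  carrier := {x | (x.den : ZMod p) ≠ 0}
  zero_mem' := by simp
  one_mem' := by simp
  add_mem' {x y} hx hy := fun h => by
    have h1 : p ∣ (x + y).den := (ZMod.natCast_eq_zero_iff _ _).1 h
    have h2 := (ZMod.natCast_eq_zero_iff _ _).2 (h1.trans (Rat.add_den_dvd x y))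
    exact mul_ne_zero hx hy (by exact_mod_cast h2)
  mul_mem' {x y} hx hy := fun h => by
    have h1 : p ∣ (x * y).den := (ZMod.natCast_eq_zero_iff _ _).1 h
    have h2 := (ZMod.natCast_eq_zero_iff _ _).2 (h1.trans (Rat.mul_den_dvd x y))
    exact mul_ne_zero hx hy (by exact_mod_cast h2)
  neg_mem' {x} hx := by simpa using hx

section PIntegers

variable (p : ℕ) [Fact p.Prime]

/-- Reduction of `p`-integral rational numbers modulo `p`. -/
def pIntegers.reduction : pIntegers p →+* ZMod p where
  toFun x := ((x : ℚ) : ZMod p)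
  map_zero' := by simp
  map_one' := by simp
  map_add' x y := Rat.cast_add_of_ne_zero x.2 y.2
  map_mul' x y := Rat.cast_mul_of_ne_zero x.2 y.2

variable {p}

theorem pIntegers.isUnit_of_reduction_ne_zero {x : pIntegers p}
    (hx : pIntegers.reduction p x ≠ 0) : IsUnit x := by
  have h0 : (((x : ℚ).num : ℤ) : ZMod p) ≠ 0 := fun h => hx (by
    change (((x : ℚ)) : ZMod p) = 0
    rw [Rat.cast_def, h, zero_div])
  have hx0 : (x : ℚ) ≠ 0 := fun h => h0 (by simp [h])
  have hmem : (x : ℚ)⁻¹ ∈ pIntegers p := by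
    change (((x : ℚ)⁻¹).den : ZMod p) ≠ 0
    intro h
    apply h0
    rw [ZMod.natCast_eq_zero_iff] at h
    rw [ZMod.intCast_zmod_eq_zero_iff_dvd] at *
    rw [Rat.inv_def] at h
    have := h.trans (by
      have := Rat.den_dvd ((x : ℚ).den : ℤ) (x : ℚ).num
      exact Int.natCast_dvd.1 (by simpa [Rat.divInt_eq_div] using this))
    exact Int.natCast_dvd.2 this
  exact IsUnit.of_mul_eq_one ⟨_, hmem⟩ (Subtype.ext (mul_inv_cancel₀ hx0))

theorem pIntegers.isUnit_natCast {n : ℕ} (hn : (n : ZMod p) ≠ 0) :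
    IsUnit (n : pIntegers p) :=
  pIntegers.isUnit_of_reduction_ne_zero (by simpa using hn)

theorem pIntegers.dvd_of_reduction_eq_zero {x : pIntegers p}
    (hx : pIntegers.reduction p x = 0) : (p : pIntegers p) ∣ x := by
  have h0 : (((x : ℚ).num : ℤ) : ZMod p) = 0 := by
    change (((x : ℚ)) : ZMod p) = 0 at hx
    rw [Rat.cast_def, div_eq_zero_iff] at hx
    exact hx.resolve_right x.2
  obtain ⟨c, hc⟩ := (ZMod.intCast_zmod_eq_zero_iff_dvd _ _).1 h0
  obtain ⟨u, hu⟩ := (pIntegers.isUnit_natCast x.2).exists_right_inv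
  refine ⟨(c : pIntegers p) * u, Subtype.ext ?_⟩
  have hu' : ((x : ℚ).den : ℚ) * (u : ℚ) = 1 := by exact_mod_cast congrArg Subtype.val hu
  have hd : ((x : ℚ).den : ℚ) * (x : ℚ) = p * c := by
    rw [Rat.den_mul_eq_num, hc]; push_cast; ring
  push_cast
  linear_combination (u : ℚ) * hd - (x : ℚ) * hu'

theorem ratModEq_of_dvd_sub {n : ℕ} {x y : pIntegers p}
    (h : (p : pIntegers p) ^ n ∣ x - y) : RatModEq (p ^ n) (x : ℚ) (y : ℚ) := by
  obtain ⟨r, hr⟩ := h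
  refine ⟨(r : ℚ).num, (r : ℚ).den, by exact_mod_cast (r : ℚ).den_nz, ?_, ?_⟩
  · have h1 : ¬ p ∣ (r : ℚ).den := fun h => r.2 ((ZMod.natCast_eq_zero_iff _ _).2 h)
    have h2 : Nat.Coprime (r : ℚ).den (p ^ n) :=
      (((Nat.Prime.coprime_iff_not_dvd Fact.out).2 h1).symm).pow_right n
    exact Nat.isCoprime_iff_coprime.2 h2
  · have := congrArg Subtype.val hr
    push_cast at this ⊢
    rw [this, Rat.num_div_den]

end PIntegers

/-! ### The coefficient sequence and the specialisation `s = -1/2` -/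

open Nat in
/-- The coefficient `(3n)! / (n! (2n+1)!)³`. -/
def summandCoeff (K : Type*) [Field K] (n : ℕ) : K :=
  ((3 * n)! : K) / ((n ! : K) * ((2 * n + 1)! : K)) ^ 3

open Nat in
theorem summandCoeff_succ {K : Type*} [Field K] (n : ℕ) (h1 : ((n + 1)! : K) ≠ 0)
    (h2 : ((2 * n + 3)! : K) ≠ 0) :
    8 * ((n : K) + 1) ^ 5 * (2 * n + 3) ^ 3 * summandCoeff K (n + 1)
      = 3 * (3 * n + 1) * (3 * n + 2) * summandCoeff K n := by
  unfold summandCoeff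
  have e1 : ((2 * (n + 1) + 1)! : K) = (2 * n + 3) * (2 * (n + 1)) * (2 * n + 1)! := by
    rw [show 2 * (n + 1) + 1 = 2 * n + 1 + 1 + 1 by ring, Nat.factorial_succ, Nat.factorial_succ]
    push_cast; ring
  have e2 : ((n + 1)! : K) = (n + 1) * n ! := by
    rw [Nat.factorial_succ]; push_cast; ring
  have e3 : ((3 * (n + 1))! : K) = (3 * (n + 1)) * (3 * n + 2) * (3 * n + 1) * (3 * n)! := by
    rw [show 3 * (n + 1) = 3 * n + 1 + 1 + 1 by ring, Nat.factorial_succ, Nat.factorial_succ,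
      Nat.factorial_succ]
    push_cast; ring
  rw [show 2 * n + 3 = 2 * (n + 1) + 1 by ring, e1] at h2
  rw [e2] at h1
  have a2 : (n ! : K) ≠ 0 := right_ne_zero_of_mul h1
  have a3 : ((2 * n + 1)! : K) ≠ 0 := right_ne_zero_of_mul h2
  rw [e1, e2, e3, mul_div_assoc', mul_div_assoc',
    div_eq_div_iff (pow_ne_zero _ (mul_ne_zero h1 h2)) (pow_ne_zero _ (mul_ne_zero a2 a3))]
  ring

open Nat in
theorem fallingFactorial_neg_half (n : ℕ) :
    fallingFactorial (-1 / 2 : ℚ) n * (4 ^ n * n !) = (-1) ^ n * (2 * n)! := by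
  induction n with
  | zero => simp
  | succ n ih =>
    rw [fallingFactorial_succ, Nat.factorial_succ, show 2 * (n + 1) = 2 * n + 1 + 1 by ring,
      Nat.factorial_succ, Nat.factorial_succ]
    push_cast
    linear_combination (-2 * (2 * (n : ℚ) + 1) * (n + 1)) * ih

theorem fallingFactorial_sub_half (n : ℕ) :
    fallingFactorial ((n : ℚ) - 1 / 2) n = (-1) ^ n * fallingFactorial (-1 / 2) n := by
  rw [← fallingFactorial_reflect]
  congr 1
  ring

open Nat in
theorem choose_mul_factorial_mul_factorial_rat (m n : ℕ) :
    ((m + n).choose m : ℚ) * (m ! * n !) = (m + n)! := by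
  have := Nat.add_choose_mul_factorial_mul_factorial m n
  rw [← Nat.choose_symm_add] at this
  rw [← mul_assoc]
  exact_mod_cast this

open Nat in
theorem shiftedTerm_neg_half (n : ℕ) :
    shiftedTerm (summandCoeff ℚ) (-1 / 2) n
      = (-1 : ℚ) ^ n * (172 * (n : ℚ) ^ 2 + 75 * (n : ℚ) + 9) / (2 : ℚ) ^ (12 * n) *
          ((2 * n).choose n : ℚ) ^ 3 * ((3 * n).choose n : ℚ) * ((4 * n).choose (2 * n) : ℚ) := by
  have h1 : fallingFactorial (-1 / 2 : ℚ) n = (-1) ^ n * (2 * n)! / (4 ^ n * n !) := by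
    rw [eq_div_iff (by positivity), fallingFactorial_neg_half]
  have h2 : fallingFactorial (-1 / 2 : ℚ) (2 * n) = (4 * n)! / (16 ^ n * (2 * n)!) := by
    have := fallingFactorial_neg_half (2 * n)
    rw [eq_div_iff (by positivity)]
    rw [show 2 * (2 * n) = 4 * n by ring, pow_mul, pow_mul] at this
    simpa [show (4 : ℚ) ^ 2 = 16 by norm_num, ← mul_assoc] using this
  have h3 : fallingFactorial (-1 / 2 + n : ℚ) (3 * n)
      = (-1) ^ n * fallingFactorial (-1 / 2) n * fallingFactorial (-1 / 2) (2 * n) := by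
    rw [show 3 * n = n + 2 * n by ring, fallingFactorial_add, ← fallingFactorial_sub_half]
    congr 2 <;> ring
  have c1 : ((2 * n).choose n : ℚ) = (2 * n)! / (n ! * n !) := by
    rw [eq_div_iff (by positivity), two_mul n,
      choose_mul_factorial_mul_factorial_rat]
  have c2 : ((3 * n).choose n : ℚ) = (3 * n)! / (n ! * (2 * n)!) := by
    rw [eq_div_iff (by positivity), show 3 * n = n + 2 * n by ring,
      choose_mul_factorial_mul_factorial_rat]
  have c3 : ((4 * n).choose (2 * n) : ℚ) = (4 * n)! / ((2 * n)! * (2 * n)!) := by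
    rw [eq_div_iff (by positivity), show 4 * n = 2 * n + 2 * n by ring,
      choose_mul_factorial_mul_factorial_rat]
  have hd : ((2 * n + 1)! : ℚ) = (2 * n + 1) * (2 * n)! := by
    rw [Nat.factorial_succ]; push_cast; ring
  have hq : quarticFactor (n : ℚ) (-1 / 2) = (2 * n + 1) ^ 3 * (172 * n ^ 2 + 75 * n + 9) := by
    simp only [quarticFactor]; ring
  rw [shiftedTerm, h3, h2, h1, c1, c2, c3, hq, summandCoeff, hd, pow_mul 2 12]
  have e1 : ((-1 : ℚ) ^ n) ^ 2 = 1 := by rw [← pow_mul, mul_comm, pow_mul]; norm_num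
  have e2 : ((-1 : ℚ) ^ n) ^ 4 = 1 := by
    rw [show 4 = 2 * 2 by rfl, pow_mul, e1, one_pow]
  have e3 : ((2 : ℚ) ^ 12) ^ n = (4 ^ n) ^ 4 * 16 ^ n := by
    rw [pow_right_comm (4 : ℚ), ← mul_pow]; norm_num
  rw [e3]
  have hn : (2 * n + 1 : ℚ) ≠ 0 := by positivity
  have hf : (n ! : ℚ) ≠ 0 := by positivity
  have hf2 : ((2 * n)! : ℚ) ≠ 0 := by positivity
  field_simp
  rw [e2]

/-- The passage from `-1/2` to `p/2` when `p = 2M + 1`: it takes `M + 1` unit shifts, whose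
companions cancel. -/
theorem sum_shiftedTerm_neg_half_eq (M : ℕ) :
    ∑ n ∈ Finset.range (M + 1), shiftedTerm (summandCoeff ℚ) (-1 / 2) n
      = ∑ n ∈ Finset.range (M + 1), shiftedTerm (summandCoeff ℚ) ((M : ℚ) + 1 / 2) n := by
  have h := sum_shiftedTerm_add_natCast (summandCoeff ℚ) (-1 / 2) M (M + 1) fun i _ =>
    summandCoeff_succ i (by exact_mod_cast (Nat.factorial_ne_zero _))
      (by exact_mod_cast (Nat.factorial_ne_zero _))
  rw [sum_companionTerm_neg_half, add_zero] at h
  rw [← h, show -1 / 2 + ((M + 1 : ℕ) : ℚ) = M + 1 / 2 by push_cast; ring]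

/-! ### Extracting the factor `s^4` -/

section ReducedTerm

variable {R : Type*} [CommRing R]

theorem map_shiftedTerm {S : Type*} [CommRing S] (f : R →+* S) (β : ℕ → R) (s : R) (n : ℕ) :
    f (shiftedTerm β s n) = shiftedTerm (fun i => f (β i)) (f s) n := by
  simp [shiftedTerm, map_quarticFactor, map_fallingFactorial]

/-- The quotient of `shiftedTerm β s (m + 1)` by `s ^ 4`. -/
def reducedTerm (β : ℕ → R) (s : R) (m : ℕ) : R :=
  β (m + 1) * quarticFactor (m + 1 : R) s *
    (fallingFactorial (s - 1) m ^ 3 * fallingFactorial (s + m + 1) (m + 1) *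
      fallingFactorial (s - 1) (2 * m + 1))

theorem map_reducedTerm {S : Type*} [CommRing S] (f : R →+* S) (β : ℕ → R) (s : R) (m : ℕ) :
    f (reducedTerm β s m) = reducedTerm (fun i => f (β i)) (f s) m := by
  simp [reducedTerm, map_quarticFactor, map_fallingFactorial]

theorem shiftedTerm_succ (β : ℕ → R) (s : R) (m : ℕ) :
    shiftedTerm β s (m + 1) = s ^ 4 * reducedTerm β s m := by
  have h : fallingFactorial (s + ((m + 1 : ℕ) : R)) (3 * (m + 1))
      = fallingFactorial (s + m + 1) (m + 1) * (s * fallingFactorial (s - 1) (2 * m + 1)) := by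
    rw [show 3 * (m + 1) = (m + 1) + (2 * m + 1 + 1) by ring, fallingFactorial_add,
      ← fallingFactorial_succ', add_sub_cancel_right]
    rw [Nat.cast_add, Nat.cast_one, add_assoc s]
  rw [shiftedTerm, reducedTerm, h, fallingFactorial_succ']
  push_cast
  ring

theorem shiftedTerm_zero (β : ℕ → R) (s : R) :
    shiftedTerm β s 0 = β 0 * (48 * s ^ 2 - 48 * s ^ 4) := by
  simp only [shiftedTerm, quarticFactor, fallingFactorial_zero, Nat.cast_zero, mul_zero]
  ring

end ReducedTerm

/-! ### Degrees in `s` -/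

section DegreeBound

open Polynomial

variable {K : Type*} [Field K]

theorem natDegree_fallingFactorial_le (c : K) (n : ℕ) :
    (fallingFactorial (X + C c) n).natDegree ≤ n := by
  refine (natDegree_prod_le _ _).trans ?_
  refine (Finset.sum_le_card_nsmul _ _ 1 fun j _ => ?_).trans (by simp)
  compute_degree

theorem natDegree_quarticFactor_le (n : ℕ) :
    (quarticFactor (n : K[X]) X).natDegree ≤ 4 := by
  unfold quarticFactor
  compute_degree

theorem natDegree_shiftedTerm_le (β : ℕ → K) (n : ℕ) :
    (shiftedTerm (fun i => C (β i)) X n).natDegree ≤ 6 * n + 4 := by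
  have h1 := natDegree_fallingFactorial_le (0 : K) n
  have h2 := natDegree_fallingFactorial_le (n : K) (3 * n)
  have h3 := natDegree_quarticFactor_le (K := K) n
  rw [C_0, add_zero] at h1
  rw [C_eq_natCast] at h2
  unfold shiftedTerm
  beta_reduce
  have e1 := natDegree_C_mul_le (β n) (quarticFactor (n : K[X]) X)
  have e2 := natDegree_pow_le (p := fallingFactorial (X : K[X]) n) (n := 3)
  have e3 := natDegree_mul_le (p := fallingFactorial (X : K[X]) n ^ 3)
    (q := fallingFactorial (X + (n : K[X])) (3 * n))
  have e4 := natDegree_mul_le (p := C (β n) * quarticFactor (n : K[X]) X)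
    (q := fallingFactorial (X : K[X]) n ^ 3 * fallingFactorial (X + (n : K[X])) (3 * n))
  omega

end DegreeBound

/-! ### The middle terms: a polynomial identity modulo `p` -/

section Periodic

open Polynomial

variable {p : ℕ} [Fact p.Prime]

/-- Periodicity moves the zero of order `k` at `0` to every element of `ZMod p`, which would force
degree at least `k * p`. -/
theorem Polynomial.eq_zero_of_periodic_of_X_pow_dvd {f : (ZMod p)[X]} {k : ℕ}
    (hper : f.comp (X + 1) = f) (hdvd : X ^ k ∣ f) (hdeg : f.natDegree < k * p) : f = 0 := by
  have hshift : ∀ j : ℕ, f.comp (X + C (j : ZMod p)) = f := by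
    intro j
    induction j with
    | zero => simp
    | succ j ih =>
      have : (X + C ((j + 1 : ℕ) : ZMod p)) = (X + C (j : ZMod p)).comp (X + 1) := by
        simp [add_assoc, add_comm]
      rw [this, ← comp_assoc, ih, hper]
  have hroot : ∀ a : ZMod p, (X - C a) ^ k ∣ f := by
    intro a
    obtain ⟨g, hg⟩ := hdvd
    have := hshift (ZMod.val (-a))
    rw [ZMod.natCast_zmod_val] at this
    rw [← this, hg, mul_comp, pow_comp, X_comp, C_neg, ← sub_eq_add_neg]
    exact dvd_mul_right _ _
  have hprod : ∏ a : ZMod p, (X - C a) ^ k ∣ f := by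
    refine Finset.prod_dvd_of_coprime (fun a _ b _ hab => ?_) fun a _ => hroot a
    exact (pairwise_coprime_X_sub_C Function.injective_id hab).pow
  by_contra hf
  have h1 := natDegree_le_of_dvd hprod hf
  rw [natDegree_prod_of_monic _ _ fun a _ => (monic_X_sub_C a).pow k] at h1
  simp only [natDegree_pow, natDegree_X_sub_C, mul_one, Finset.sum_const, Finset.card_univ,
    ZMod.card, smul_eq_mul] at h1
  rw [mul_comm] at hdeg
  omega

theorem factorial_ne_zero_zmod {n : ℕ} (hn : n < p) : (n.factorial : ZMod p) ≠ 0 := by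
  rw [Ne, ZMod.natCast_eq_zero_iff, (Fact.out : p.Prime).dvd_factorial]
  omega

theorem factorial_eq_zero_zmod {n : ℕ} (hn : p ≤ n) : (n.factorial : ZMod p) = 0 := by
  rwa [ZMod.natCast_eq_zero_iff, (Fact.out : p.Prime).dvd_factorial]

theorem summandCoeff_eq_zero_zmod {n : ℕ} (hn : p ≤ 3 * n) : summandCoeff (ZMod p) n = 0 := by
  rw [summandCoeff, factorial_eq_zero_zmod hn, zero_div]

/-- The sequence `summandCoeff (ZMod p)` as constant polynomials. -/
noncomputable def polyCoeff (p : ℕ) [Fact p.Prime] (i : ℕ) : (ZMod p)[X] := C (summandCoeff (ZMod p) i)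

/-- The companion vanishes modulo `p`: it contains `(3m+1)(3m+2)(3m)! = (3m+2)!`, and `3m + 2 ≥ 2m +
3 = p`. -/
theorem sum_shiftedTerm_polyCoeff_comp {m : ℕ} (hp : p = 2 * m + 3) (hm : 1 ≤ m) :
    (∑ n ∈ Finset.range (m + 1), shiftedTerm (polyCoeff p) X n).comp (X + 1)
      = ∑ n ∈ Finset.range (m + 1), shiftedTerm (polyCoeff p) X n := by
  have h1 : (∑ n ∈ Finset.range (m + 1), shiftedTerm (polyCoeff p) X n).comp (X + 1)
      = ∑ n ∈ Finset.range (m + 1), shiftedTerm (polyCoeff p) (X + 1) n := by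
    rw [← coe_compRingHom_apply, map_sum]
    refine Finset.sum_congr rfl fun n _ => ?_
    rw [map_shiftedTerm]
    simp only [polyCoeff, coe_compRingHom_apply, C_comp, X_comp]
    rfl
  have h2 : (3 * (m : ZMod p) + 1) * (3 * m + 2) * summandCoeff (ZMod p) m = 0 := by
    have := factorial_eq_zero_zmod (p := p) (n := 3 * m + 1 + 1) (by omega)
    rw [Nat.factorial_succ, Nat.factorial_succ] at this
    push_cast at this
    rw [summandCoeff, mul_div_assoc', div_eq_zero_iff]
    left
    linear_combination this
  have h3 : (3 * (m : (ZMod p)[X]) + 1) * (3 * m + 2) * polyCoeff p m = 0 := by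
    have := congrArg (C : ZMod p → (ZMod p)[X]) h2
    simp only [map_mul, map_add, map_ofNat, map_one, map_zero, map_natCast] at this
    exact this
  rw [h1, ← sub_eq_zero, sum_shiftedTerm_add_one_sub]
  · rw [companionTerm, mul_assoc (-48 : (ZMod p)[X]), mul_assoc (-48 : (ZMod p)[X]), h3,
      mul_zero, zero_mul, zero_mul]
  · intro i hi
    have h4 := summandCoeff_succ (K := ZMod p) i (factorial_ne_zero_zmod (by omega))
      (factorial_ne_zero_zmod (by omega))
    have h5 := congrArg (C : ZMod p → (ZMod p)[X]) h4
    simp only [map_mul, map_add, map_ofNat, map_one, map_pow, map_natCast] at h5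
    exact h5

theorem natDegree_sum_shiftedTerm_polyCoeff_le (N : ℕ) :
    (∑ n ∈ Finset.range N, shiftedTerm (polyCoeff p) X n).natDegree ≤ 2 * p + 2 := by
  refine natDegree_sum_le_of_forall_le _ _ fun n _ => ?_
  -- Coefficients with `3n ≥ p` vanish; otherwise `6n + 4 ≤ 2(p - 1) + 4`.
  by_cases hn : p ≤ 3 * n
  · simp [shiftedTerm, polyCoeff, summandCoeff_eq_zero_zmod hn]
  · exact (natDegree_shiftedTerm_le _ n).trans (by omega)

/-- Both sides are periodic with degree below `4p`, and both are `48 X^2` modulo `X^4`, so their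
difference is zero. -/
theorem sum_shiftedTerm_polyCoeff {m : ℕ} (hp : p = 2 * m + 3) (hm : 1 ≤ m) :
    ∑ n ∈ Finset.range (m + 1), shiftedTerm (polyCoeff p) X n = C 48 * (X ^ p - X) ^ 2 := by
  have hp5 : 5 ≤ p := by omega
  obtain ⟨q, hq⟩ := Nat.exists_eq_add_of_le hp5
  rw [← sub_eq_zero]
  refine Polynomial.eq_zero_of_periodic_of_X_pow_dvd (k := 4) ?_ ?_ ?_
  · rw [sub_comp, sum_shiftedTerm_polyCoeff_comp hp hm, mul_comp, pow_comp, sub_comp, pow_comp,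
      X_comp, C_comp, add_pow_char, one_pow, add_sub_add_right_eq_sub]
  · rw [Finset.sum_range_succ', Finset.sum_congr rfl fun i _ => shiftedTerm_succ _ _ i,
      ← Finset.mul_sum, shiftedTerm_zero, add_sub_assoc]
    refine dvd_add (dvd_mul_right _ _) ?_
    have h0 : polyCoeff p 0 = 1 := by simp [polyCoeff, summandCoeff]
    have hX : (X : (ZMod p)[X]) ^ p = X ^ (5 + q) := by rw [← hq]
    rw [h0, hX, map_ofNat]
    exact ⟨-48 + 96 * X ^ (q + 2) - 48 * X ^ (2 * q + 6), by ring⟩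
  · have e0 : (X ^ p - X : (ZMod p)[X]).natDegree ≤ p := by
      refine (natDegree_sub_le _ _).trans ?_
      simp only [natDegree_X_pow, natDegree_X]
      omega
    have e1 := natDegree_C_mul_le (48 : ZMod p) ((X ^ p - X) ^ 2)
    have e2 := natDegree_pow_le (p := (X ^ p - X : (ZMod p)[X])) (n := 2)
    refine (natDegree_sub_le _ _).trans_lt (max_lt ?_ ?_)
    · exact (natDegree_sum_shiftedTerm_polyCoeff_le _).trans_lt (by omega)
    · omega

/-- Comparison of the coefficients of `X^4`: the term `n = 0` contributes `-48`, while `48 (X^p -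
X)^2` has none because `p ≥ 5`. -/
theorem sum_reducedTerm_zmod {m : ℕ} (hp : p = 2 * m + 3) (hm : 1 ≤ m) :
    ∑ i ∈ Finset.range m, reducedTerm (summandCoeff (ZMod p)) 0 i = 48 := by
  have hp5 : 5 ≤ p := by omega
  obtain ⟨q, hq⟩ := Nat.exists_eq_add_of_le hp5
  have h := sum_shiftedTerm_polyCoeff hp hm
  have h0 : polyCoeff p 0 = 1 := by simp [polyCoeff, summandCoeff]
  have hX : (X : (ZMod p)[X]) ^ p = X ^ (5 + q) := by rw [← hq]
  rw [Finset.sum_range_succ', Finset.sum_congr rfl fun i _ => shiftedTerm_succ _ _ i,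
    ← Finset.mul_sum, shiftedTerm_zero, h0, hX, map_ofNat] at h
  have h1 : (X : (ZMod p)[X]) ^ 4 * (∑ i ∈ Finset.range m, reducedTerm (polyCoeff p) X i)
      = X ^ 4 * (48 - 96 * X ^ (q + 2) + 48 * X ^ (2 * q + 6)) := by
    linear_combination h
  have h2 := congrArg (evalRingHom 0) (mul_left_cancel₀ (pow_ne_zero 4 X_ne_zero) h1)
  rw [map_sum, Finset.sum_congr rfl fun i _ => map_reducedTerm _ _ _ i] at h2
  simpa [polyCoeff] using h2

end Periodic

/-! ### The top term in closed form -/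

section HarmonicProduct

/-- The product `∏_{i=1}^{M} (1 + x / i)`. -/
def harmonicProduct (M : ℕ) (x : ℚ) : ℚ := ∏ i ∈ Finset.range M, (1 + x / ((i : ℚ) + 1))

open Nat

theorem fallingFactorial_sub_one_eq (M : ℕ) (x : ℚ) :
    fallingFactorial (x - 1) M = (-1) ^ M * M ! * harmonicProduct M (-x) := by
  induction M with
  | zero => simp [harmonicProduct]
  | succ M ih =>
    rw [fallingFactorial_succ, ih, harmonicProduct, harmonicProduct, Finset.prod_range_succ,
      Nat.factorial_succ]
    have : (M : ℚ) + 1 ≠ 0 := by positivity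
    push_cast
    field_simp
    ring

theorem fallingFactorial_add_self_eq (M : ℕ) (x : ℚ) :
    fallingFactorial (x + M) M = M ! * harmonicProduct M x := by
  have h := fallingFactorial_reflect (-x - 1) M
  rw [fallingFactorial_sub_one_eq, neg_neg, ← mul_assoc, ← mul_assoc, ← mul_pow] at h
  rw [show x + (M : ℚ) = M - 1 - (-x - 1) by ring, h]
  norm_num

theorem factorial_add_eq_mul_harmonicProduct (n M : ℕ) :
    ((n + M)! : ℚ) = n ! * M ! * harmonicProduct M n := by
  induction M with
  | zero => simp [harmonicProduct]
  | succ M ih =>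
    rw [← add_assoc, Nat.factorial_succ, Nat.cast_mul, ih, harmonicProduct, harmonicProduct,
      Finset.prod_range_succ, Nat.factorial_succ]
    have : (M : ℚ) + 1 ≠ 0 := by positivity
    push_cast
    field_simp
    ring

theorem factorial_two_mul_eq_harmonicProduct_neg_half (M : ℕ) (q : ℚ) (hq : q = 2 * M + 1) :
    ((2 * M)! : ℚ) = (-1) ^ M * 4 ^ M * (M ! : ℚ) ^ 2 * harmonicProduct M (-(q / 2)) := by
  have h1 := fallingFactorial_sub_one_eq M (q / 2)
  rw [show q / 2 - 1 = (M : ℚ) - 1 / 2 by rw [hq]; ring, fallingFactorial_sub_half] at h1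
  have h2 := fallingFactorial_neg_half M
  have h3 : ((-1 : ℚ) ^ M) * (-1) ^ M = 1 := by rw [← mul_pow]; norm_num
  linear_combination (4 ^ M * (M ! : ℚ)) * h1 - (-1) ^ M * h2 - ((2 * M)! : ℚ) * h3

/-- The numerator carries `q^5` (three from the cubed falling factorial, one from the long one, one
from `(3M)!`) against `q^3` below, leaving `q^2`. The factor `q + m + 1` completes `(3M)!` to
`(3M+1)!`, and `q - 2` completes a block of `M - 1` factors to `M`. -/
theorem shiftedTerm_half_top (m : ℕ) (q : ℚ) (hq : q = 2 * m + 3) :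
    shiftedTerm (summandCoeff ℚ) (q / 2) (m + 1) * ((q + m + 1) * (q - 2) * (4 ^ (m + 1)) ^ 2)
      = -q ^ 2 * quarticFactor (m + 1 : ℚ) (q / 2) * harmonicProduct (m + 1) q
        * harmonicProduct (m + 1) (q / 2) * harmonicProduct (m + 1) (-(q / 2)) ^ 3 := by
  have hq' : q = 2 * ((m + 1 : ℕ) : ℚ) + 1 := by rw [hq]; push_cast; ring
  set M := m + 1 with hM
  set u := harmonicProduct M (-(q / 2)) with hu
  have hf : (M ! : ℚ) ≠ 0 := by positivity
  have hq0 : q ≠ 0 := by rw [hq]; positivity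
  have hsq : ((-1 : ℚ) ^ M) ^ 2 = 1 := by rw [← pow_mul, mul_comm, pow_mul]; norm_num
  have hsgn : ((-1 : ℚ) ^ M) ≠ 0 := pow_ne_zero _ (by norm_num)
  have hc := factorial_two_mul_eq_harmonicProduct_neg_half M q hq'
  have hg : ((2 * M + 1)! : ℚ) = q * ((-1) ^ M * 4 ^ M * (M ! : ℚ) ^ 2 * u) := by
    rw [Nat.factorial_succ, Nat.cast_mul, hc, ← hu]
    push_cast
    linear_combination (-((-1) ^ M * 4 ^ M * (M ! : ℚ) ^ 2 * u)) * hq'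
  have hu0 : u ≠ 0 := by
    intro h
    rw [h, mul_zero, mul_zero] at hg
    exact (Nat.factorial_ne_zero _) (by exact_mod_cast hg)
  have h1 : fallingFactorial (q / 2) (M + 1) = q / 2 * ((-1) ^ M * M ! * u) := by
    rw [fallingFactorial_succ', fallingFactorial_sub_one_eq]
  have h2 : fallingFactorial (q / 2) M = q * ((-1) ^ M * M ! * u) := by
    have := h1
    rw [fallingFactorial_succ, show q / 2 - (M : ℚ) = 1 / 2 by rw [hq']; ring] at this
    linear_combination 2 * this
  have h3 : fallingFactorial (-1 / 2 : ℚ) m * (-((q - 2) / 2)) = M ! * u := by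
    have e1 := fallingFactorial_succ (-1 / 2 : ℚ) m
    have e2 := fallingFactorial_sub_half M
    rw [show (M : ℚ) - 1 / 2 = q / 2 - 1 by rw [hq']; ring, fallingFactorial_sub_one_eq,
      mul_assoc] at e2
    rw [mul_left_cancel₀ hsgn e2, e1, hq]
    ring
  have h4 : fallingFactorial (q / 2 + (M : ℚ)) (3 * M) * (q - 2)
      = -(M ! * harmonicProduct M (q / 2)) * (q * ((-1) ^ M * M ! * u)) * (M ! * u) := by
    -- The `3M` factors split into those above `s = q/2`, those from `s` down to `1/2`, and those
    -- from `-1/2` down.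
    rw [show 3 * M = M + (M + 1 + m) by omega, fallingFactorial_add (q / 2 + M) M (M + 1 + m),
      add_sub_cancel_right, fallingFactorial_add (q / 2) (M + 1) m, fallingFactorial_add_self_eq, h1, ← h3,
      show q / 2 - ((M + 1 : ℕ) : ℚ) = -1 / 2 by rw [hq']; push_cast; ring]
    ring
  have h5 : ((3 * M)! : ℚ) * (q + m + 1) = (2 * M + 1)! * M ! * harmonicProduct M q := by
    have := factorial_add_eq_mul_harmonicProduct (2 * M + 1) M
    rw [show 2 * M + 1 + M = 3 * M + 1 by ring, Nat.factorial_succ] at this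
    have e : ((2 * M + 1 : ℕ) : ℚ) = q := by rw [hq']; push_cast; ring
    rw [e] at this
    rw [← this, hq, hM]
    push_cast; ring
  rw [shiftedTerm, summandCoeff, h2]
  have hMc : (M : ℚ) = m + 1 := by rw [hM]; push_cast; ring
  rw [hMc] at h4 ⊢
  set V := quarticFactor (m + 1 : ℚ) (q / 2)
  set F := fallingFactorial (q / 2 + (m + 1 : ℚ)) (3 * M)
  set a := harmonicProduct M q
  set b := harmonicProduct M (q / 2)
  set g : ℚ := ((2 * M + 1)! : ℚ)
  have hg0 : g ≠ 0 := by positivity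
  calc ((3 * M)! : ℚ) / (M ! * g) ^ 3 * V * ((q * ((-1) ^ M * M ! * u)) ^ 3 * F)
        * ((q + m + 1) * (q - 2) * (4 ^ M) ^ 2)
      = (((3 * M)! : ℚ) * (q + m + 1)) * (F * (q - 2)) * V * (q * ((-1) ^ M * M ! * u)) ^ 3
        * (4 ^ M) ^ 2 / (M ! * g) ^ 3 := by ring
    _ = -V * a * b * (((-1) ^ M) ^ 2) ^ 2 * u ^ 5 * q ^ 4 * (M ! : ℚ) ^ 4 * (4 ^ M) ^ 2 / g ^ 2 := by
      rw [h5, h4]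
      field_simp
    _ = -q ^ 2 * V * a * b * u ^ 3 := by
      rw [hg, hsq]
      field_simp
      rw [hsq]
      ring

end HarmonicProduct

/-! ### Harmonic products modulo `p^3` -/

/-- The second elementary symmetric function is written through power sums; doubling avoids dividing
by `2`. -/
theorem sum_one_add_mul_prod {R : Type*} [CommRing R] (c : R) (x : ℕ → R) (M : ℕ) :
    ∃ r, 2 * ∏ i ∈ Finset.range M, (1 + c * x i)
      = 2 + 2 * c * ∑ i ∈ Finset.range M, x i
        + c ^ 2 * ((∑ i ∈ Finset.range M, x i) ^ 2 - ∑ i ∈ Finset.range M, x i ^ 2)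
        + c ^ 3 * r := by
  induction M with
  | zero => exact ⟨0, by simp⟩
  | succ M ih =>
    obtain ⟨r, hr⟩ := ih
    refine ⟨r + r * c * x M + x M * ((∑ i ∈ Finset.range M, x i) ^ 2
      - ∑ i ∈ Finset.range M, x i ^ 2), ?_⟩
    simp only [Finset.prod_range_succ, Finset.sum_range_succ]
    linear_combination (1 + c * x M) * hr

/-- Inverse squares are the powers `x^(p-3)`, whose sum over the field is zero; the exponent is
even, so `x ↦ -x` makes the two halves equal. -/
theorem sum_inv_sq_zmod {p M : ℕ} [Fact p.Prime] (hp : p = 2 * M + 1) (hM : 2 ≤ M) :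
    ∑ i ∈ Finset.range M, ((i : ZMod p) + 1)⁻¹ ^ 2 = 0 := by
  have h1 : ∑ x : ZMod p, x ^ (p - 3) = 0 :=
    FiniteField.sum_pow_lt_card_sub_one (ZMod p) (p - 3) (by rw [ZMod.card]; omega)
  have h2 : ∑ x : ZMod p, x ^ (p - 3) = ∑ k ∈ Finset.range p, (k : ZMod p) ^ (p - 3) := by
    refine Finset.sum_nbij' (fun x => ZMod.val x) (fun k => (k : ZMod p)) ?_ ?_ ?_ ?_ ?_
    · exact fun x _ => Finset.mem_range.2 (ZMod.val_lt x)
    · simp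
    · exact fun x _ => ZMod.natCast_zmod_val x
    · exact fun k hk => ZMod.val_cast_of_lt (Finset.mem_range.1 hk)
    · exact fun x _ => by rw [ZMod.natCast_zmod_val]
  have h3 : ∀ i ∈ Finset.range M, ((i : ZMod p) + 1) ^ (p - 3) = ((i : ZMod p) + 1)⁻¹ ^ 2 := by
    intro i hi
    rw [Finset.mem_range] at hi
    have h0 : ((i : ZMod p) + 1) ≠ 0 := by
      have : ((i + 1 : ℕ) : ZMod p) ≠ 0 := by
        rw [Ne, ZMod.natCast_eq_zero_iff]
        exact Nat.not_dvd_of_pos_of_lt (by omega) (by omega)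
      exact_mod_cast this
    rw [inv_pow]
    refine eq_inv_of_mul_eq_one_left ?_
    rw [← pow_add, show p - 3 + 2 = p - 1 by omega]
    exact ZMod.pow_card_sub_one_eq_one h0
  have h4 : ∑ k ∈ Finset.range p, (k : ZMod p) ^ (p - 3)
      = 2 * ∑ i ∈ Finset.range M, ((i : ZMod p) + 1) ^ (p - 3) := by
    have e1 : ∀ i ∈ Finset.range M, (((M + (M - 1 - i)) : ℕ) : ZMod p) + 1 = -((i : ZMod p) + 1) := by
      intro i hi
      rw [Finset.mem_range] at hi
      have : (((M + (M - 1 - i)) + 1 + (i + 1) : ℕ) : ZMod p) = 0 := by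
        rw [show M + (M - 1 - i) + 1 + (i + 1) = p by omega]
        simp
      push_cast at this ⊢
      linear_combination this
    have e2 := Finset.sum_range_reflect (fun j => (((M + j : ℕ) : ZMod p) + 1) ^ (p - 3)) M
    have e3 : Finset.range p = Finset.range (2 * M + 1) := congrArg _ hp
    rw [e3, Finset.sum_range_succ', two_mul M, Finset.sum_range_add, two_mul]
    push_cast at e2 ⊢
    rw [zero_pow (by omega), add_zero, ← e2]
    congr 1
    refine Finset.sum_congr rfl fun i hi => ?_
    have := e1 i hi
    push_cast at this
    rw [this, Even.neg_pow ⟨M - 1, by omega⟩]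
  rw [← Finset.sum_congr rfl h3]
  have h5 : (2 : ZMod p) ≠ 0 := by
    have : ((2 : ℕ) : ZMod p) ≠ 0 := by
      rw [Ne, ZMod.natCast_eq_zero_iff]
      exact Nat.not_dvd_of_pos_of_lt (by omega) (by omega)
    exact_mod_cast this
  rw [h1, h4] at h2
  exact (mul_eq_zero.1 h2.symm).resolve_left h5

section Congruences

/-- Here `a`, `b`, `u` are `exp(2e)`, `exp(e)`, `exp(-e)` truncated at `e^3 = 0`, and `2 + 1 - 3 =
0`. -/
theorem truncatedExp_relation {Q : Type*} [CommRing Q] {h e a b u : Q} (hh : 2 * h = 1)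
    (he : e ^ 3 = 0) (ha : 2 * a = 2 + 4 * e + 4 * e ^ 2)
    (hb : 2 * b = 2 + 2 * e + e ^ 2) (hu : 2 * u = 2 - 2 * e + e ^ 2) :
    a * b * u ^ 3 = 1 := by
  have ha' : a = 1 + 2 * e + 2 * e ^ 2 := by
    linear_combination h * ha + (1 + 2 * e + 2 * e ^ 2 - a) * hh
  have hb' : b = 1 + e + h * e ^ 2 := by
    linear_combination h * hb + (1 + e - b) * hh
  have hu' : u = 1 - e + h * e ^ 2 := by
    linear_combination h * hu + (1 - e - u) * hh
  have huu : u ^ 2 = 1 - 2 * e + 2 * e ^ 2 := by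
    rw [hu']
    linear_combination e ^ 2 * hh + (h ^ 2 * e - 2 * h) * he
  have hbu : b * u = 1 := by
    rw [hb', hu']
    linear_combination e ^ 2 * hh + h ^ 2 * e * he
  have hau : a * u ^ 2 = 1 := by
    rw [ha', huu]
    linear_combination 4 * e * he
  linear_combination u ^ 2 * a * hbu + hau

variable {p : ℕ} [Fact p.Prime]

theorem natCast_ne_zero_zmod {n : ℕ} (h0 : 0 < n) (hn : n < p) : (n : ZMod p) ≠ 0 := by
  rw [Ne, ZMod.natCast_eq_zero_iff]
  exact Nat.not_dvd_of_pos_of_lt h0 hn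

theorem pIntegers.exists_half (hp : 2 < p) : ∃ h : pIntegers p, 2 * h = 1 := by
  have := (pIntegers.isUnit_natCast (natCast_ne_zero_zmod (p := p) two_pos hp)).exists_right_inv
  exact_mod_cast this

open Nat in
theorem pIntegers.exists_summandCoeff (p : ℕ) [Fact p.Prime] :
    ∃ b : ℕ → pIntegers p, ∀ n, 2 * n + 1 < p →
      (b n : ℚ) = summandCoeff ℚ n ∧ pIntegers.reduction p (b n) = summandCoeff (ZMod p) n := by
  -- `Ring.inverse` is `0` on non-units, which makes the sequence total; only `2n + 1 < p` matters.
  refine ⟨fun n => ((3 * n)! : pIntegers p) *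
    Ring.inverse (((n ! : pIntegers p) * ((2 * n + 1)! : pIntegers p)) ^ 3), fun n hn => ?_⟩
  have h1 := factorial_ne_zero_zmod (p := p) (n := n) (by omega)
  have h2 := factorial_ne_zero_zmod hn
  have hu : IsUnit (((n ! : pIntegers p) * ((2 * n + 1)! : pIntegers p)) ^ 3) :=
    ((pIntegers.isUnit_natCast h1).mul (pIntegers.isUnit_natCast h2)).pow 3
  have h := Ring.mul_inverse_cancel _ hu
  constructor
  · have h3 := congrArg (pIntegers p).subtype h
    simp only [map_mul, map_pow, map_natCast, map_one] at h3
    rw [← Subring.coe_subtype, map_mul, map_natCast, summandCoeff, div_eq_mul_inv,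
      ← eq_inv_of_mul_eq_one_right h3]
  · have h3 := congrArg (pIntegers.reduction p) h
    simp only [map_mul, map_pow, map_natCast, map_one] at h3
    rw [map_mul, map_natCast, summandCoeff, div_eq_mul_inv, ← eq_inv_of_mul_eq_one_right h3]

theorem pIntegers.exists_sum_reducedTerm {m : ℕ} (hp : p = 2 * m + 3) (hm : 1 ≤ m) :
    ∃ T : pIntegers p,
      (T : ℚ) = ∑ i ∈ Finset.range m, reducedTerm (summandCoeff ℚ) ((p : ℚ) / 2) i ∧
      (p : pIntegers p) ∣ T - 48 := by
  obtain ⟨b, hb⟩ := pIntegers.exists_summandCoeff p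
  obtain ⟨h, hh⟩ := pIntegers.exists_half (p := p) (by omega)
  refine ⟨∑ i ∈ Finset.range m, reducedTerm b (p * h) i, ?_, ?_⟩
  · have h1 := congrArg (pIntegers p).subtype hh
    simp only [map_mul, map_ofNat, map_one] at h1
    rw [← Subring.coe_subtype, map_sum]
    refine Finset.sum_congr rfl fun i hi => ?_
    rw [Finset.mem_range] at hi
    rw [map_reducedTerm, map_mul, map_natCast,
      show (p : ℚ) * (pIntegers p).subtype h = p / 2 by linear_combination (p / 2 : ℚ) * h1]
    simp only [reducedTerm, Subring.coe_subtype, (hb (i + 1) (by omega)).1]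
  · apply pIntegers.dvd_of_reduction_eq_zero
    rw [map_sub, map_sum, map_ofNat, sub_eq_zero, ← sum_reducedTerm_zmod hp hm]
    refine Finset.sum_congr rfl fun i hi => ?_
    rw [Finset.mem_range] at hi
    rw [map_reducedTerm, map_mul, map_natCast, ZMod.natCast_self, zero_mul]
    simp only [reducedTerm, (hb (i + 1) (by omega)).2]

/-- The reciprocal of `i + 1` in the ring of `p`-integers, when `i + 1 < p`. -/
noncomputable def pIntegers.invSucc (p : ℕ) [Fact p.Prime] (i : ℕ) : pIntegers p :=
  Ring.inverse ((i + 1 : ℕ) : pIntegers p)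

theorem pIntegers.mul_invSucc {i : ℕ} (hi : i + 1 < p) :
    ((i + 1 : ℕ) : pIntegers p) * pIntegers.invSucc p i = 1 :=
  Ring.mul_inverse_cancel _
    (pIntegers.isUnit_natCast (natCast_ne_zero_zmod (Nat.succ_pos i) hi))

theorem pIntegers.coe_prod_invSucc {M : ℕ} (hM : M < p) (c : pIntegers p) :
    ((∏ i ∈ Finset.range M, (1 + c * pIntegers.invSucc p i) : pIntegers p) : ℚ)
      = harmonicProduct M c := by
  rw [← Subring.coe_subtype, map_prod, harmonicProduct]
  refine Finset.prod_congr rfl fun i hi => ?_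
  rw [Finset.mem_range] at hi
  have h := congrArg (pIntegers p).subtype (pIntegers.mul_invSucc (p := p) (i := i) (by omega))
  rw [map_mul, map_natCast, map_one] at h
  have h0 : (i : ℚ) + 1 ≠ 0 := by positivity
  push_cast at h
  rw [map_add, map_mul, map_one, div_eq_mul_inv, ← eq_inv_of_mul_eq_one_right h]

theorem pIntegers.dvd_sum_invSucc_sq {M : ℕ} (hp : p = 2 * M + 1) (hM : 2 ≤ M) :
    (p : pIntegers p) ∣ ∑ i ∈ Finset.range M, pIntegers.invSucc p i ^ 2 := by
  apply pIntegers.dvd_of_reduction_eq_zero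
  rw [map_sum, ← sum_inv_sq_zmod hp hM]
  refine Finset.sum_congr rfl fun i hi => ?_
  rw [Finset.mem_range] at hi
  have h := congrArg (pIntegers.reduction p)
    (pIntegers.mul_invSucc (p := p) (i := i) (by omega))
  rw [map_mul, map_natCast, map_one] at h
  push_cast at h
  rw [map_pow, eq_inv_of_mul_eq_one_right h]

/-- Modulo `p ^ 3` the products `∏ (1 + c / i)` with `p ∣ c` are truncated exponentials. -/
theorem pIntegers.two_mul_prod_invSucc {M : ℕ} (hp : p = 2 * M + 1) (hM : 2 ≤ M)
    (ε : pIntegers p) :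
    (p : pIntegers p) ^ 3 ∣ 2 * ∏ i ∈ Finset.range M, (1 + (p * ε) * pIntegers.invSucc p i)
      - (2 + 2 * (p * ε) * ∑ i ∈ Finset.range M, pIntegers.invSucc p i
        + (p * ε) ^ 2 * (∑ i ∈ Finset.range M, pIntegers.invSucc p i) ^ 2) := by
  obtain ⟨r, hr⟩ := sum_one_add_mul_prod (p * ε) (pIntegers.invSucc p) M
  obtain ⟨t, ht⟩ := pIntegers.dvd_sum_invSucc_sq hp hM
  refine ⟨ε ^ 3 * r - ε ^ 2 * t, ?_⟩
  rw [hr, ht]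
  ring

theorem pIntegers.prod_invSucc_relations {M : ℕ} (hp : p = 2 * M + 1) (hM : 2 ≤ M)
    {h a b u : pIntegers p} (hh : 2 * h = 1)
    (ha : a = ∏ i ∈ Finset.range M, (1 + p * pIntegers.invSucc p i))
    (hb : b = ∏ i ∈ Finset.range M, (1 + (p * h) * pIntegers.invSucc p i))
    (hu : u = ∏ i ∈ Finset.range M, (1 + (p * -h) * pIntegers.invSucc p i)) :
    (p : pIntegers p) ^ 3 ∣ a * b * u ^ 3 - 1 := by
  have ea := pIntegers.two_mul_prod_invSucc hp hM 1
  have eb := pIntegers.two_mul_prod_invSucc hp hM h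
  have eu := pIntegers.two_mul_prod_invSucc hp hM (-h)
  rw [mul_one, ← ha] at ea
  rw [← hb] at eb
  rw [← hu] at eu
  set I := Ideal.span {(p : pIntegers p) ^ 3}
  set φ := Ideal.Quotient.mk I
  have key : ∀ z : pIntegers p, φ z = 0 ↔ (p : pIntegers p) ^ 3 ∣ z := fun z => by
    rw [Ideal.Quotient.eq_zero_iff_mem, Ideal.mem_span_singleton]
  rw [← key] at ea eb eu ⊢
  have hp3 : φ (p : pIntegers p) ^ 3 = 0 := by
    rw [← map_pow]; exact (key _).2 dvd_rfl
  have hh' : 2 * φ h = 1 := by rw [← map_ofNat φ 2, ← map_mul, hh, map_one]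
  set s := ∑ i ∈ Finset.range M, pIntegers.invSucc p i
  simp only [map_sub, map_add, map_mul, map_pow, map_neg, map_one, map_ofNat] at ea eb eu ⊢
  rw [truncatedExp_relation (h := φ h) (e := φ p * φ h * φ s) hh' ?_ ?_ ?_ ?_, sub_self]
  · linear_combination (φ h * φ s) ^ 3 * hp3
  · linear_combination ea - (2 * φ p * φ s + φ p ^ 2 * φ s ^ 2 * (2 * φ h + 1)) * hh'
  · linear_combination eb
  · linear_combination eu

/-- Modulo `p^3` the harmonic products multiply to `1` and the quartic factor is `3 (p + m + 1)(p -
2)`, which cancels the denominator of the closed form. -/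
theorem pIntegers.exists_top_shiftedTerm {m : ℕ} (hp : p = 2 * m + 3) (hm : 1 ≤ m) :
    ∃ L : pIntegers p,
      (L : ℚ) = shiftedTerm (summandCoeff ℚ) ((p : ℚ) / 2) (m + 1) ∧
      (p : pIntegers p) ^ 5 ∣ L * (4 ^ (m + 1)) ^ 2 + 3 * (p : pIntegers p) ^ 2 := by
  have hpQ : (p : ℚ) = 2 * m + 3 := by rw [hp]; push_cast; ring
  have hpR : (p : pIntegers p) = 2 * m + 3 := by
    have := congrArg (Nat.cast : ℕ → pIntegers p) hp
    push_cast at this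
    exact this
  have hp' : p = 2 * (m + 1) + 1 := by omega
  obtain ⟨h, hh⟩ := pIntegers.exists_half (p := p) (by omega)
  have hhQ : (h : ℚ) = 1 / 2 := by
    have := congrArg (pIntegers p).subtype hh
    simp only [map_mul, map_ofNat, map_one] at this
    rw [eq_div_iff two_ne_zero, mul_comm]
    exact this
  set a := ∏ i ∈ Finset.range (m + 1), (1 + p * pIntegers.invSucc p i) with ha
  set b := ∏ i ∈ Finset.range (m + 1), (1 + (p * h) * pIntegers.invSucc p i) with hb
  set u := ∏ i ∈ Finset.range (m + 1), (1 + (p * -h) * pIntegers.invSucc p i) with hu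
  have haQ : (a : ℚ) = harmonicProduct (m + 1) p := by
    rw [ha, pIntegers.coe_prod_invSucc (by omega)]; simp
  have hbQ : (b : ℚ) = harmonicProduct (m + 1) (p / 2) := by
    rw [hb, pIntegers.coe_prod_invSucc (by omega)]
    push_cast; rw [hhQ]; congr 1; ring
  have huQ : (u : ℚ) = harmonicProduct (m + 1) (-(p / 2)) := by
    rw [hu, pIntegers.coe_prod_invSucc (by omega)]
    push_cast; rw [hhQ]; congr 1; ring
  obtain ⟨r, hr⟩ := pIntegers.prod_invSucc_relations hp' (by omega) hh ha hb hu
  have w1 : IsUnit ((p + m + 1 : ℕ) : pIntegers p) := by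
    apply pIntegers.isUnit_natCast
    rw [show p + m + 1 = p + (m + 1) by ring, Nat.cast_add, ZMod.natCast_self, zero_add]
    exact natCast_ne_zero_zmod (by omega) (by omega)
  have w2 : IsUnit ((2 * m + 1 : ℕ) : pIntegers p) :=
    pIntegers.isUnit_natCast (natCast_ne_zero_zmod (by omega) (by omega))
  have w4 : IsUnit (((2 : ℕ) : pIntegers p)) :=
    pIntegers.isUnit_natCast (natCast_ne_zero_zmod (by omega) (by omega))
  have w3 : IsUnit ((4 : pIntegers p) ^ (m + 1)) := by
    have : (4 : pIntegers p) = ((2 : ℕ) : pIntegers p) ^ 2 := by norm_num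
    rw [this]
    exact (w4.pow 2).pow _
  have w := (w1.mul w2).mul (w3.pow 2)
  set D : pIntegers p := ((p + m + 1 : ℕ) : pIntegers p) * ((2 * m + 1 : ℕ) : pIntegers p)
    * (4 ^ (m + 1)) ^ 2 with hD
  set V := quarticFactor (m + 1 : pIntegers p) (p * h) with hV
  have hVQ : (V : ℚ) = quarticFactor (m + 1 : ℚ) (p / 2) := by
    rw [hV, ← Subring.coe_subtype, map_quarticFactor]
    simp only [map_add, map_mul, map_natCast, map_one, Subring.coe_subtype, hhQ]
    congr 1; ring
  obtain ⟨D', hD'⟩ := w.exists_right_inv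
  have hDQ : (D : ℚ) = (p + m + 1) * (p - 2) * (4 ^ (m + 1)) ^ 2 := by
    have c4 : ((4 : pIntegers p) : ℚ) = 4 := map_ofNat (pIntegers p).subtype 4
    have c2 : ((2 : pIntegers p) : ℚ) = 2 := map_ofNat (pIntegers p).subtype 2
    rw [hD]; push_cast; rw [hpQ, c4, c2]; ring
  have hD'Q : (D : ℚ) * D' = 1 := congrArg (pIntegers p).subtype hD'
  set N : pIntegers p := -p ^ 2 * V * a * b * u ^ 3 with hN
  refine ⟨N * D', ?_, ?_⟩
  · have h1 := shiftedTerm_half_top m p hpQ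
    rw [← hDQ, ← haQ, ← hbQ, ← huQ, ← hVQ] at h1
    rw [hN]
    push_cast
    linear_combination (-(D' : ℚ)) * h1
      + shiftedTerm (summandCoeff ℚ) ((p : ℚ) / 2) (m + 1) * hD'Q
  · have hfac : N * D' * (4 ^ (m + 1)) ^ 2 + 3 * (p : pIntegers p) ^ 2
        = (N * (4 ^ (m + 1)) ^ 2 + 3 * p ^ 2 * D) * D' := by
      linear_combination (-3 * (p : pIntegers p) ^ 2) * hD'
    rw [hfac]
    apply Dvd.dvd.mul_right
    have hτ : 2 * (p * h) + 1 = (p : pIntegers p) + 1 := by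
      linear_combination (p : pIntegers p) * hh
    -- Here `n = m + 1` and `s = p/2`, so `2n + 1 = p` and `2s + 1 = p + 1`; also `2m + 1 = p - 2`.
    have hVmod : V = 3 * ((p + m + 1 : ℕ) : pIntegers p) * ((2 * m + 1 : ℕ) : pIntegers p)
        + p ^ 3 * (64 * (m + 1) ^ 2 - 48 * (m + 1) + 12) := by
      rw [hV, quarticFactor, hτ]
      push_cast
      rw [hpR]
      ring
    refine ⟨-(4 ^ (m + 1)) ^ 2 * ((64 * (m + 1) ^ 2 - 48 * (m + 1) + 12) * (1 + p ^ 3 * r)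
      + 3 * ((p + m + 1 : ℕ) : pIntegers p) * ((2 * m + 1 : ℕ) : pIntegers p) * r), ?_⟩
    rw [hN, hD, hVmod]
    linear_combination (-p ^ 2 * (3 * ((p + m + 1 : ℕ) : pIntegers p) *
      ((2 * m + 1 : ℕ) : pIntegers p) + p ^ 3 * (64 * (m + 1) ^ 2 - 48 * (m + 1) + 12)) *
      (4 ^ (m + 1)) ^ 2) * hr

end Congruences

/-! ### Assembling the three contributions -/

theorem pIntegers.sum_congruence {p m : ℕ} [Fact p.Prime] (hp : p = 2 * m + 3) (hm : 1 ≤ m) :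
    ∃ S y : pIntegers p,
      (S : ℚ) = ∑ n ∈ Finset.range (m + 2), shiftedTerm (summandCoeff ℚ) (-1 / 2) n ∧
      (y : ℚ) = 2 ^ (p - 1) ∧
      (p : pIntegers p) ^ 5 ∣ S - (p : pIntegers p) ^ 2 * (9 + 6 * (y - 1) - 9 * (y - 1) ^ 2) := by
  have hpQ : (p : ℚ) = 2 * m + 3 := by rw [hp]; push_cast; ring
  obtain ⟨T, hT, t, ht⟩ := pIntegers.exists_sum_reducedTerm hp hm
  obtain ⟨L, hL, l, hl⟩ := pIntegers.exists_top_shiftedTerm hp hm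
  obtain ⟨h, hh⟩ := pIntegers.exists_half (p := p) (by omega)
  have hhQ : (2 : ℚ) * (h : ℚ) = 1 := by
    have := congrArg (pIntegers p).subtype hh
    rwa [map_mul, map_ofNat, map_one] at this
  have c2 : ((2 : pIntegers p) : ℚ) = 2 := map_ofNat (pIntegers p).subtype 2
  have c4 : ((4 : pIntegers p) : ℚ) = 4 := map_ofNat (pIntegers p).subtype 4
  have c48 : ((48 : pIntegers p) : ℚ) = 48 := map_ofNat (pIntegers p).subtype 48
  set s : pIntegers p := p * h with hs
  have hsQ : (s : ℚ) = p / 2 := by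
    rw [hs]; push_cast; linear_combination ((p : ℚ) / 2) * hhQ
  refine ⟨48 * s ^ 2 - 48 * s ^ 4 + s ^ 4 * T + L, 4 ^ (m + 1), ?_, ?_, ?_⟩
  · rw [sum_shiftedTerm_neg_half_eq,
      show ((m + 1 : ℕ) : ℚ) + 1 / 2 = p / 2 by rw [hpQ]; push_cast; ring,
      Finset.sum_range_succ, Finset.sum_range_succ', shiftedTerm_zero,
      Finset.sum_congr rfl fun i _ => shiftedTerm_succ _ _ i, ← Finset.mul_sum, ← hT, ← hL]
    push_cast
    rw [hsQ, c48]
    simp [summandCoeff]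
    ring
  · push_cast
    rw [c4, show p - 1 = 2 * (m + 1) by omega, pow_mul]
    norm_num
  · have hy : (p : pIntegers p) ∣ 4 ^ (m + 1) - 1 := by
      apply pIntegers.dvd_of_reduction_eq_zero
      have h2 : (2 : ZMod p) ≠ 0 := by
        exact_mod_cast natCast_ne_zero_zmod (p := p) (n := 2) (by omega) (by omega)
      have := ZMod.pow_card_sub_one_eq_one h2
      rw [show p - 1 = 2 * (m + 1) by omega, pow_mul] at this
      norm_num at this
      rw [map_sub, map_pow, map_ofNat, map_one, this, sub_self]
    obtain ⟨x, hx⟩ := hy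
    have hyu : IsUnit ((4 : pIntegers p) ^ (m + 1)) := by
      apply pIntegers.isUnit_of_reduction_ne_zero
      rw [eq_add_of_sub_eq hx, map_add, map_mul, map_natCast, ZMod.natCast_self]
      simp
    -- Multiplying by the unit `y^2` clears the denominator of the top term.
    rw [← (hyu.pow 2).dvd_mul_right]
    have hy' := eq_add_of_sub_eq hx
    have h2s : 48 * s ^ 2 = 12 * (p : pIntegers p) ^ 2 := by
      rw [hs]; linear_combination (12 * (p : pIntegers p) ^ 2) * (2 * h + 1) * hh
    have hs4 : s ^ 4 * (T - 48) = (p : pIntegers p) ^ 5 * (h ^ 4 * t) := by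
      rw [ht, hs]; ring
    -- With `z = p x`, `(3 - 6z + 9z^2)(1 + z)^2 = 3 + 12 z^3 + 9 z^4` yields the last two summands.
    refine ⟨h ^ 4 * t * (4 ^ (m + 1)) ^ 2 + l + 12 * x ^ 3 + 9 * p * x ^ 4, ?_⟩
    rw [hy'] at hl ⊢
    linear_combination (p * x + 1) ^ 2 * h2s + (p * x + 1) ^ 2 * hs4 + hl

theorem theorem1p1 (p : ℕ) (hp : p.Prime) (hodd : Odd p) :
    RatModEq (p ^ 5)
      (∑ k ∈ Finset.range ((p - 1) / 2 + 1),
        (-1 : ℚ) ^ k * (172 * (k : ℚ) ^ 2 + 75 * (k : ℚ) + 9) / (2 : ℚ) ^ (12 * k) *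
          ((2 * k).choose k : ℚ) ^ 3 * ((3 * k).choose k : ℚ) * ((4 * k).choose (2 * k) : ℚ))
      (9 * (p : ℚ) ^ 2 + 6 * (p : ℚ) ^ 3 * fermatQuotient p 2
        - 9 * (p : ℚ) ^ 4 * fermatQuotient p 2 ^ 2) := by
  have : Fact p.Prime := ⟨hp⟩
  have hp0 : (p : ℚ) ≠ 0 := by exact_mod_cast hp.ne_zero
  obtain ⟨k, hk⟩ := hodd
  obtain rfl | hk1 : k = 1 ∨ 2 ≤ k := by
    have := hp.two_le
    omega
  -- For `p = 3` the sum is `9 - 9 = 0` and the right side is `-486 = -2 * 3^5`.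
  · refine ⟨2, 1, one_ne_zero, isCoprime_one_left, ?_⟩
    subst hk
    norm_num [Finset.sum_range_succ, fermatQuotient, Nat.choose]
  · obtain ⟨m, rfl⟩ := Nat.exists_eq_add_of_le' hk1
    obtain ⟨S, y, hS, hy, hdvd⟩ :=
      pIntegers.sum_congruence (p := p) (m := m + 1) (by omega) (by omega)
    have c6 : ((6 : pIntegers p) : ℚ) = 6 := map_ofNat (pIntegers p).subtype 6
    have c9 : ((9 : pIntegers p) : ℚ) = 9 := map_ofNat (pIntegers p).subtype 9
    convert ratModEq_of_dvd_sub hdvd using 1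
    · rw [hS, show (p - 1) / 2 + 1 = m + 1 + 2 by omega]
      exact Finset.sum_congr rfl fun n _ => (shiftedTerm_neg_half n).symm
    · push_cast
      rw [hy, fermatQuotient, c6, c9]
      push_cast
      field_simp
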